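/- For a natural number $N$ let $(N)_2$ be its canonical base-2 representation, without leading zeros ($(0)_2$ is the empty string). $N$ is a binary square if $N=0$ or $(N)_2=yy$ for some nonempty binary string $y$ starting with $1$. An integer $N$ has length $n\ge 1$ if $2^{n-1}\le N<2^n$. In the following, summands need not be distinct. (a) Let $n\ge 13$ be odd. Every integer of length $n$ is a sum of binary squares in at least one of the following ways: (i) one of length $n-1$ and one of length $n-3$; (ii) two of length $n-1$ and one of length $n-3$; (iii) one of length $n-1$ and two of length $n-3$; (iv) one each of lengths $n-1$, $n-3$ and $n-5$; (v) two of length $n-1$ and two of length $n-3$; (vi) two of length $n-1$, one of length $n-3$ and one of length $n-5$. (b) Let $n\ge 18$ be even. Every integer of length $n$ is a sum of binary squares in at least one of the following ways: (i) two of length $n-2$ and two of length $n-4$; (ii) three of length $n-2$ and one of length $n-4$; (iii) one each of lengths $n$, $n-4$ and $n-6$; (iv) two of length $n-2$, one of length $n-4$ and one of length $n-6$. -/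

import Mathlib

/-- The canonical base-2 representation of `N`, most significant bit first and without leading
zeros; the representation of `0` is the empty string. -/
def binRep (N : ℕ) : List ℕ := (Nat.digits 2 N).reverse

/-- `N` is a binary square: `N = 0`, or the canonical binary representation of `N` is `yy` for some
nonempty string `y` that starts with a `1`. -/
def IsBinarySquare (N : ℕ) : Prop :=
  N = 0 ∨ ∃ y : List ℕ, y.head? = some 1 ∧ binRep N = y ++ y

/-- `N` is an integer of (binary) length `n`, i.e. an `n`-bit integer. -/
def HasBinLength (N n : ℕ) : Prop :=
  1 ≤ n ∧ 2 ^ (n - 1) ≤ N ∧ N < 2 ^ n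

/-- The set of binary squares of length `n`. -/
def binSquares (n : ℕ) : Set ℕ :=
  {s | IsBinarySquare s ∧ HasBinLength s n}

/-! Each a(2^m + 1) with 2^(m-1) ≤ a < 2^m is a square of length 2m, so N must be written as a
combination of numbers 2^m + 1 with coefficients in prescribed intervals. Sums of one or two
cofactors of equal length fill an unbroken interval. Two consecutive moduli satisfy 2(2Q+1) - (4Q+1)
= 1, so N = A(4Q+1) + r(2Q+1) with r in any window of 4Q+1 integers, and the size of N then confines
A. When r is too small to be a cofactor, the next smaller modulus absorbs the defect through an
integer relation among the three moduli (`odd_representation`). For even lengths A can overshoot its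
range, or N can be large; then one square of length n is used, by solving 6B + 7C ≡ 8N mod 8Q+1
(`exists_representation_of_residue`). -/

/-- If `a` has exactly `m` binary digits, then `a * (2 ^ m + 1)` is a binary square of length
`2 * m`. -/
lemma mul_mem_binSquares {m n a : ℕ} (hm : 1 ≤ m) (hn : n = 2 * m) (h1 : 2 ^ (m - 1) ≤ a)
    (h2 : a < 2 ^ m) : a * (2 ^ m + 1) ∈ binSquares n := by
  subst hn
  have ha : a ≠ 0 := by
    have : 0 < 2 ^ (m - 1) := by positivity
    omega
  have hlen : (Nat.digits 2 a).length = m := by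
    rw [Nat.length_digits 2 a (by norm_num) ha, (Nat.log_eq_iff (Or.inr ⟨by norm_num, ha⟩)).2
      ⟨h1, by rwa [Nat.sub_add_cancel hm]⟩, Nat.sub_add_cancel hm]
  have hdig : Nat.digits 2 (a * (2 ^ m + 1)) = Nat.digits 2 a ++ Nat.digits 2 a := by
    rw [Nat.digits_append_digits (by norm_num), hlen]
    congr 1
    ring
  refine ⟨Or.inr ⟨(Nat.digits 2 a).reverse, ?_, ?_⟩, by omega, ?_, ?_⟩
  · have hne : Nat.digits 2 a ≠ [] := Nat.digits_ne_nil_iff_ne_zero.2 ha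
    rw [List.head?_reverse, List.getLast?_eq_getLast_of_ne_nil hne]
    have h0 := Nat.getLast_digit_ne_zero 2 ha
    have h3 : (Nat.digits 2 a).getLast hne < 2 :=
      Nat.digits_lt_base (by norm_num) (List.getLast_mem hne)
    congr 1
    omega
  · rw [binRep, hdig, List.reverse_append]
  · calc 2 ^ (2 * m - 1) = 2 ^ (m - 1) * 2 ^ m := by rw [← pow_add]; congr 1; omega
      _ ≤ a * (2 ^ m + 1) := Nat.mul_le_mul h1 (Nat.le_succ _)
  · calc a * (2 ^ m + 1) < (a + 1) * 2 ^ m := by rw [mul_add, add_mul]; omega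
      _ ≤ 2 ^ m * 2 ^ m := Nat.mul_le_mul_right _ h2
      _ = 2 ^ (2 * m) := by rw [← pow_add]; congr 1; omega

lemma exists_add_of_le_of_lt {L x : ℕ} (h1 : 2 * L ≤ x) (h2 : x + 2 ≤ 4 * L) :
    ∃ y z, L ≤ y ∧ y < 2 * L ∧ L ≤ z ∧ z < 2 * L ∧ x = y + z :=
  ⟨x / 2, x - x / 2, by omega, by omega, by omega, by omega, by omega⟩

lemma exists_add_add_of_le_of_lt {L x : ℕ} (h1 : 3 * L ≤ x) (h2 : x + 3 ≤ 6 * L) :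
    ∃ y z w, L ≤ y ∧ y < 2 * L ∧ L ≤ z ∧ z < 2 * L ∧ L ≤ w ∧ w < 2 * L ∧ x = y + z + w :=
  ⟨x / 3, (x - x / 3) / 2, x - x / 3 - (x - x / 3) / 2, by omega, by omega, by omega, by omega,
    by omega, by omega, by omega⟩

/-- Every integer is congruent to an element of any given window of length `m`. -/
lemma exists_eq_add_mul_of_pos {m : ℤ} (hm : 0 < m) (x lo : ℤ) :
    ∃ r q : ℤ, x = r + m * q ∧ lo ≤ r ∧ r < lo + m :=
  ⟨lo + (x - lo) % m, (x - lo) / m, by linarith [Int.emod_add_mul_ediv (x - lo) m],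
    by linarith [Int.emod_nonneg (x - lo) hm.ne'], by linarith [Int.emod_lt_of_pos (x - lo) hm]⟩

/-- Because 2(2Q+1) - (4Q+1) = 1, r is 2N modulo 4Q+1. The window starts at -2 so that it ends at
4Q-2, the largest sum of two integers below 2Q. -/
lemma exists_eq_mul_add_mul {Q : ℤ} (hQ : 0 < Q) (N : ℤ) :
    ∃ A r : ℤ, N = A * (4 * Q + 1) + r * (2 * Q + 1) ∧ -2 ≤ r ∧ r ≤ 4 * Q - 2 := by
  obtain ⟨r, q, h, h1, h2⟩ := exists_eq_add_mul_of_pos (by omega : 0 < 4 * Q + 1) (2 * N) (-2)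
  exact ⟨q * (2 * Q + 1) - N, r, by linear_combination (2 * Q + 1) * h, h1, by omega⟩

/-! ### Odd lengths: the arithmetic -/

lemma odd_representation {P N : ℤ} (hP : 4 ≤ P) (h1 : 16 * (4 * P) ^ 2 ≤ N)
    (h2 : N < 32 * (4 * P) ^ 2) :
    (∃ A B : ℤ, N = A * (16 * P + 1) + B * (8 * P + 1) ∧ 8 * P ≤ A ∧ A ≤ 32 * P - 2 ∧
      4 * P ≤ B ∧ B ≤ 16 * P - 2) ∨
    (∃ A B C : ℤ, N = A * (16 * P + 1) + B * (8 * P + 1) + C * (4 * P + 1) ∧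
      8 * P ≤ A ∧ A ≤ 32 * P - 2 ∧ 4 * P ≤ B ∧ B ≤ 8 * P - 1 ∧ 2 * P ≤ C ∧ C ≤ 4 * P - 1) := by
  obtain ⟨A, r, h, hr1, hr2⟩ := exists_eq_mul_add_mul (by omega : 0 < 4 * P) N
  have e1 : 0 ≤ P * (16 * P - 2 - r) := mul_nonneg (by omega) (by omega)
  have e2 : 0 ≤ P * (r + 2) := mul_nonneg (by omega) (by omega)
  by_cases hr : 4 * P ≤ r
  · have e3 : 0 ≤ P * (r - 4 * P) := mul_nonneg (by omega) (by omega)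
    refine Or.inl ⟨A, r, by linear_combination h, ?_, ?_, hr, by omega⟩ <;> by_contra! hA
    · have e4 : 0 ≤ P * (8 * P - 1 - A) := mul_nonneg (by omega) (by omega)
      nlinarith
    · have e4 : 0 ≤ P * (A - (32 * P - 1)) := mul_nonneg (by omega) (by omega)
      nlinarith
  · have e3 : 0 ≤ P * (4 * P - 1 - r) := mul_nonneg (by omega) (by omega)
    have hA1 : 13 * P ≤ A := by
      by_contra! hA
      have e4 : 0 ≤ P * (13 * P - 1 - A) := mul_nonneg (by omega) (by omega)
      nlinarith
    have hA2 : A ≤ 33 * P := by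
      by_contra! hA
      have e4 : 0 ≤ P * (A - (33 * P + 1)) := mul_nonneg (by omega) (by omega)
      nlinarith
    right
    -- Both witnesses add (-4P, 8P-1, 1) + j(1, -3, 2) to (A, r, 0); these two vectors are relations
    -- among 16P+1, 8P+1, 4P+1. Taking j = P or j = 2P-1 gives the least or the greatest odd C in
    -- its range.
    by_cases hr3 : r ≤ 3 * P
    · exact ⟨A + P - 4 * P, r + 5 * P - 1, 2 * P + 1, by linear_combination h, by omega, by omega,
        by omega, by omega, by omega, by omega⟩
    · exact ⟨A + (2 * P - 1) - 4 * P, r + 2 * P + 2, 4 * P - 1, by linear_combination h,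
        by omega, by omega, by omega, by omega, by omega, by omega⟩

/-! ### Even lengths: the arithmetic -/

/-- Representations with one summand divisible by `8 * Q + 1`, found by writing a suitable residue
`t` of `8 * N` modulo `8 * Q + 1` as `6 * B + 7 * C`. -/
lemma exists_representation_of_residue {Q N t m : ℤ} (hQ : 64 ≤ Q) (h2 : N < 64 * Q ^ 2)
    (h : 8 * N = t + (8 * Q + 1) * m) (ht1 : 10 * Q + 4 ≤ t) (ht2 : t ≤ 18 * Q + 4)
    (hs : 232 * Q ^ 2 + Q * t + 34 * Q + 42 ≤ 7 * N)
    (hl : Q * (t - 4 * Q + 24) ≤ 3 * (N - 32 * Q ^ 2)) :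
    ∃ D B C : ℤ, N = D * (8 * Q + 1) + B * (2 * Q + 1) + C * (Q + 1) ∧
      4 * Q ≤ D ∧ D ≤ 8 * Q - 1 ∧ Q ≤ B ∧ B ≤ 2 * Q - 1 ∧ Q ≤ 2 * C ∧ C ≤ Q - 1 := by
  -- Modulo 8Q+1 one has 8(2Q+1) ≡ 6, 8(Q+1) ≡ 7, and 8 has inverse -Q, so t = 6B + 7C makes the
  -- remainder a multiple of 8Q+1. The last conjunct forces D ≥ 4Q; `h2` gives D < 8Q.
  suffices hBC : ∃ B C : ℤ, t = 6 * B + 7 * C ∧ Q ≤ B ∧ B ≤ 2 * Q - 1 ∧ Q ≤ 2 * C ∧ C ≤ Q - 1 ∧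
      B * (2 * Q + 1) + C * (Q + 1) + (4 * Q - 1) * (8 * Q + 1) < N by
    obtain ⟨B, C, rfl, hB1, hB2, hC1, hC2, hN⟩ := hBC
    have hD : N = (N - Q * m - B - C) * (8 * Q + 1) + B * (2 * Q + 1) + C * (Q + 1) := by
      linear_combination -Q * h
    generalize N - Q * m - B - C = D at hD
    refine ⟨D, B, C, hD, ?_, ?_, hB1, hB2, hC1, hC2⟩
    · by_contra! hlt
      have : 0 ≤ (4 * Q - 1 - D) * (8 * Q + 1) := mul_nonneg (by omega) (by omega)
      linarith
    · by_contra! hlt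
      have e1 : 0 ≤ (D - 8 * Q) * (8 * Q + 1) := mul_nonneg (by omega) (by omega)
      have e2 : 0 ≤ B * (2 * Q + 1) := mul_nonneg (by omega) (by omega)
      have e3 : 0 ≤ C * (Q + 1) := mul_nonneg (by omega) (by omega)
      nlinarith
  -- B(2Q+1) + C(Q+1) must stay small. Per unit of t, C costs about Q/7 and B about Q/3: for small t
  -- keep B near its minimum Q (bound `hs`), for large t keep C near its maximum Q-1 (bound `hl`).
  by_cases ht : t ≤ 13 * Q - 7
  · obtain ⟨B, C, hB1, hB2, hBC⟩ : ∃ B C : ℤ, Q ≤ B ∧ B ≤ Q + 6 ∧ t = 6 * B + 7 * C :=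
      ⟨Q + (-t - Q) % 7, (t - 6 * (Q + (-t - Q) % 7)) / 7, by omega, by omega, by omega⟩
    refine ⟨B, C, hBC, hB1, by omega, by omega, by omega, ?_⟩
    have e : 0 ≤ Q * (Q + 6 - B) := mul_nonneg (by omega) (by omega)
    subst hBC
    nlinarith
  · obtain ⟨B, C, hC1, hC2, hBC⟩ : ∃ B C : ℤ, Q - 6 ≤ C ∧ C ≤ Q - 1 ∧ t = 6 * B + 7 * C :=
      ⟨(t - 7 * (Q - 6 + (t - Q) % 6)) / 6, Q - 6 + (t - Q) % 6, by omega, by omega, by omega⟩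
    refine ⟨B, C, hBC, by omega, by omega, by omega, by omega, ?_⟩
    have e : 0 ≤ Q * (C - (Q - 6)) := mul_nonneg (by omega) (by omega)
    subst hBC
    nlinarith

/-- Put Q = 8R. For N ≥ 37Q² every residue t admits the third form. Below that, N bounds 2A + r, so
whenever A is too large for two summands, t is small enough for the third form. -/
lemma even_representation {R N : ℤ} (hR : 8 ≤ R) (h1 : 32 * (8 * R) ^ 2 ≤ N)
    (h2 : N < 64 * (8 * R) ^ 2) :
    (∃ A B : ℤ, N = A * (32 * R + 1) + B * (16 * R + 1) ∧ 32 * R ≤ A ∧ A ≤ 64 * R - 2 ∧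
      16 * R ≤ B ∧ B ≤ 32 * R - 2) ∨
    (∃ A B : ℤ, N = A * (32 * R + 1) + B * (16 * R + 1) ∧ 48 * R ≤ A ∧ A ≤ 96 * R - 3 ∧
      8 * R ≤ B ∧ B ≤ 16 * R - 1) ∨
    (∃ D B C : ℤ, N = D * (64 * R + 1) + B * (16 * R + 1) + C * (8 * R + 1) ∧
      32 * R ≤ D ∧ D ≤ 64 * R - 1 ∧ 8 * R ≤ B ∧ B ≤ 16 * R - 1 ∧ 4 * R ≤ C ∧ C ≤ 8 * R - 1) ∨
    (∃ A B C : ℤ, N = A * (32 * R + 1) + B * (16 * R + 1) + C * (8 * R + 1) ∧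
      32 * R ≤ A ∧ A ≤ 64 * R - 2 ∧ 8 * R ≤ B ∧ B ≤ 16 * R - 1 ∧ 4 * R ≤ C ∧ C ≤ 8 * R - 1) := by
  have key : ∀ t m : ℤ, 8 * N = t + (64 * R + 1) * m → 80 * R + 4 ≤ t → t ≤ 144 * R + 4 →
      232 * (8 * R) ^ 2 + 8 * R * t + 272 * R + 42 ≤ 7 * N →
      8 * R * (t - 32 * R + 24) ≤ 3 * (N - 32 * (8 * R) ^ 2) →
      ∃ D B C : ℤ, N = D * (64 * R + 1) + B * (16 * R + 1) + C * (8 * R + 1) ∧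
        32 * R ≤ D ∧ D ≤ 64 * R - 1 ∧ 8 * R ≤ B ∧ B ≤ 16 * R - 1 ∧ 4 * R ≤ C ∧
        C ≤ 8 * R - 1 := by
    intro t m h ht1 ht2 hs hl
    obtain ⟨D, B, C, hN, hD1, hD2, hB1, hB2, hC1, hC2⟩ :=
      exists_representation_of_residue (Q := 8 * R) (N := N) (t := t) (m := m) (by omega) h2
        (by linear_combination h) (by omega) (by omega) (by linarith) (by linarith)
    exact ⟨D, B, C, by linear_combination hN, by omega, by omega, by omega, by omega, by omega,
      by omega⟩
  have hRR : 0 ≤ R * (R - 8) := mul_nonneg (by omega) (by omega)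
  -- At the worst t, about 18Q, `hl` asks for N - 32Q² ≥ 14Q²/3 to leading order, hence 37.
  by_cases hN : 37 * (8 * R) ^ 2 ≤ N
  · obtain ⟨t, m, h, ht1, ht2⟩ :=
      exists_eq_add_mul_of_pos (by omega : 0 < 64 * R + 1) (8 * N) (80 * R + 4)
    have e : 0 ≤ R * (144 * R + 4 - t) := mul_nonneg (by omega) (by omega)
    exact Or.inr (Or.inr (Or.inl (key t m h ht1 (by omega) (by nlinarith) (by nlinarith))))
  push Not at hN
  obtain ⟨A, r, h, hr1, hr2⟩ := exists_eq_mul_add_mul (by omega : 0 < 8 * R) N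
  have e1 : 0 ≤ R * (32 * R - 2 - r) := mul_nonneg (by omega) (by omega)
  have e2 : 0 ≤ R * (r + 2) := mul_nonneg (by omega) (by omega)
  have hA1 : 47 * R ≤ A := by
    by_contra! hA
    have e4 : 0 ≤ R * (47 * R - 1 - A) := mul_nonneg (by omega) (by omega)
    nlinarith
  by_cases hr3 : 16 * R ≤ r
  · by_cases hA : A ≤ 64 * R - 2
    · exact Or.inl ⟨A, r, by linear_combination h, by omega, hA, hr3, by omega⟩
    have hr4 : r ≤ 21 * R := by
      by_contra! hlt
      have e5 : 0 ≤ R * (r - 21 * R) := mul_nonneg (by omega) (by omega)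
      have e4 : 0 ≤ R * (A - (64 * R - 1)) := mul_nonneg (by omega) (by omega)
      nlinarith
    have hA2 : A ≤ 66 * R := by
      by_contra! hlt
      have e5 : 0 ≤ R * (r - 16 * R) := mul_nonneg (by omega) (by omega)
      have e4 : 0 ≤ R * (A - 66 * R) := mul_nonneg (by omega) (by omega)
      nlinarith
    have e4 : 0 ≤ R * (A - (64 * R - 1)) := mul_nonneg (by omega) (by omega)
    have e5 : 0 ≤ R * (r - 16 * R) := mul_nonneg (by omega) (by omega)
    -- Modulo 64R+1, 8(32R+1) ≡ 4 and 8(16R+1) ≡ 6, so 8N ≡ 4A + 6r; subtracting 4 copies of the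
    -- modulus (3 when r < 8R) lands in the window.
    refine Or.inr (Or.inr (Or.inl (key (4 * A + 6 * r - 4 * (64 * R + 1)) (4 * A + 2 * r + 4)
      (by linear_combination 8 * h) (by omega) (by omega) ?_ ?_))) <;> nlinarith
  by_cases hr4 : 8 * R ≤ r
  · refine Or.inr (Or.inl ⟨A, r, by linear_combination h, ?_, ?_, hr4, by omega⟩) <;> by_contra! hlt
    · have e3 : 0 ≤ R * (16 * R - 1 - r) := mul_nonneg (by omega) (by omega)
      have e4 : 0 ≤ R * (48 * R - 1 - A) := mul_nonneg (by omega) (by omega)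
      nlinarith
    · have e4 : 0 ≤ R * (A - (96 * R - 2)) := mul_nonneg (by omega) (by omega)
      nlinarith
  have hA2 : 2 * A + r ≤ 149 * R := by
    by_contra! hlt
    have e4 : 0 ≤ R * (2 * A + r - 149 * R) := mul_nonneg (by omega) (by omega)
    nlinarith
  right; right
  -- The relation from the odd case with P = 2R: j = 2R for r ≤ 6R, j = 3R otherwise.
  by_cases hr5 : r ≤ 6 * R
  · by_cases hA : A ≤ 70 * R - 2
    · exact Or.inr ⟨A + 2 * R - 8 * R, r + 10 * R - 1, 4 * R + 1, by linear_combination h,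
        by omega, by omega, by omega, by omega, by omega, by omega⟩
    have e4 : 0 ≤ R * (A - (70 * R - 1)) := mul_nonneg (by omega) (by omega)
    refine Or.inl (key (4 * A + 6 * r - 3 * (64 * R + 1)) (4 * A + 2 * r + 3)
      (by linear_combination 8 * h) (by omega) (by omega) ?_ ?_) <;> nlinarith
  · by_cases hA : A ≤ 69 * R - 2
    · exact Or.inr ⟨A + 3 * R - 8 * R, r + 7 * R - 1, 6 * R + 1, by linear_combination h,
        by omega, by omega, by omega, by omega, by omega, by omega⟩
    have e4 : 0 ≤ R * (A - (69 * R - 1)) := mul_nonneg (by omega) (by omega)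
    have e5 : 0 ≤ R * (r - 6 * R) := mul_nonneg (by omega) (by omega)
    refine Or.inl (key (4 * A + 6 * r - 3 * (64 * R + 1)) (4 * A + 2 * r + 3)
      (by linear_combination 8 * h) (by omega) (by omega) ?_ ?_) <;> nlinarith

/-! ### Back to binary squares: splitting A and B into cofactors -/

theorem lemma5 :
    -- part (a): odd lengths
    (∀ n : ℕ, Odd n → 13 ≤ n → ∀ N : ℕ, HasBinLength N n →
      (∃ a ∈ binSquares (n - 1), ∃ b ∈ binSquares (n - 3),
        N = a + b) ∨
      (∃ a ∈ binSquares (n - 1), ∃ b ∈ binSquares (n - 1), ∃ c ∈ binSquares (n - 3),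
        N = a + b + c) ∨
      (∃ a ∈ binSquares (n - 1), ∃ b ∈ binSquares (n - 3), ∃ c ∈ binSquares (n - 3),
        N = a + b + c) ∨
      (∃ a ∈ binSquares (n - 1), ∃ b ∈ binSquares (n - 3), ∃ c ∈ binSquares (n - 5),
        N = a + b + c) ∨
      (∃ a ∈ binSquares (n - 1), ∃ b ∈ binSquares (n - 1),
        ∃ c ∈ binSquares (n - 3), ∃ d ∈ binSquares (n - 3),
        N = a + b + c + d) ∨
      (∃ a ∈ binSquares (n - 1), ∃ b ∈ binSquares (n - 1),
        ∃ c ∈ binSquares (n - 3), ∃ d ∈ binSquares (n - 5),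
        N = a + b + c + d)) ∧
    -- part (b): even lengths
    (∀ n : ℕ, Even n → 18 ≤ n → ∀ N : ℕ, HasBinLength N n →
      (∃ a ∈ binSquares (n - 2), ∃ b ∈ binSquares (n - 2),
        ∃ c ∈ binSquares (n - 4), ∃ d ∈ binSquares (n - 4),
        N = a + b + c + d) ∨
      (∃ a ∈ binSquares (n - 2), ∃ b ∈ binSquares (n - 2),
        ∃ c ∈ binSquares (n - 2), ∃ d ∈ binSquares (n - 4),
        N = a + b + c + d) ∨
      (∃ a ∈ binSquares n, ∃ b ∈ binSquares (n - 4), ∃ c ∈ binSquares (n - 6),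
        N = a + b + c) ∨
      (∃ a ∈ binSquares (n - 2), ∃ b ∈ binSquares (n - 2),
        ∃ c ∈ binSquares (n - 4), ∃ d ∈ binSquares (n - 6),
        N = a + b + c + d)) := by
  constructor
  · rintro n ⟨k, rfl⟩ hn N ⟨-, hN1, hN2⟩
    obtain ⟨k, rfl⟩ : ∃ l, k = l + 4 := ⟨k - 4, by omega⟩
    have hP : 4 ≤ 2 ^ k := (by norm_num : 4 = 2 ^ 2) ▸ Nat.pow_le_pow_right (by norm_num) (by omega)
    have hx : ∀ a, 2 * (4 * 2 ^ k) ≤ a → a < 2 * (2 * (4 * 2 ^ k)) →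
        a * (16 * 2 ^ k + 1) ∈ binSquares (2 * (k + 4) + 1 - 1) := fun a h1 h2 ↦ by
      have := mul_mem_binSquares (m := k + 4) (n := 2 * (k + 4) + 1 - 1) (a := a) (by omega)
        (by omega) (by rw [show k + 4 - 1 = k + 3 by omega, pow_add]; omega)
        (by rw [pow_add]; omega)
      rwa [pow_add, mul_comm (2 ^ k)] at this
    have hy : ∀ a, 4 * 2 ^ k ≤ a → a < 2 * (4 * 2 ^ k) →
        a * (8 * 2 ^ k + 1) ∈ binSquares (2 * (k + 4) + 1 - 3) := fun a h1 h2 ↦ by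
      have := mul_mem_binSquares (m := k + 3) (n := 2 * (k + 4) + 1 - 3) (a := a) (by omega)
        (by omega) (by rw [show k + 3 - 1 = k + 2 by omega, pow_add]; omega)
        (by rw [pow_add]; omega)
      rwa [pow_add, mul_comm (2 ^ k)] at this
    have hz : ∀ a, 2 * 2 ^ k ≤ a → a < 4 * 2 ^ k →
        a * (4 * 2 ^ k + 1) ∈ binSquares (2 * (k + 4) + 1 - 5) := fun a h1 h2 ↦ by
      have := mul_mem_binSquares (m := k + 2) (n := 2 * (k + 4) + 1 - 5) (a := a) (by omega)
        (by omega) (by rw [show k + 2 - 1 = k + 1 by omega, pow_add]; omega)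
        (by rw [pow_add]; omega)
      rwa [pow_add, mul_comm (2 ^ k)] at this
    have hN1' : 16 * (4 * 2 ^ k) ^ 2 ≤ N := by
      rw [show 2 * (k + 4) + 1 - 1 = k + k + 8 by omega, pow_add, pow_add] at hN1
      linarith
    have hN2' : N < 32 * (4 * 2 ^ k) ^ 2 := by
      rw [show 2 * (k + 4) + 1 = k + k + 9 by omega, pow_add, pow_add] at hN2
      linarith
    generalize 2 ^ k = P at *
    rcases odd_representation (P := P) (N := N) (by exact_mod_cast hP) (by exact_mod_cast hN1')
      (by exact_mod_cast hN2') with ⟨A, B, hN, hA1, hA2, hB1, hB2⟩ |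
        ⟨A, B, C, hN, hA1, hA2, hB1, hB2, hC1, hC2⟩
    · lift A to ℕ using by omega
      lift B to ℕ using by omega
      have hN : N = A * (16 * P + 1) + B * (8 * P + 1) := by exact_mod_cast hN
      by_cases hA : A < 4 * (4 * P) <;> by_cases hB : B < 2 * (4 * P)
      · exact Or.inl ⟨_, hx A (by omega) (by omega), _, hy B (by omega) (by omega), hN⟩
      · obtain ⟨b, c, hb1, hb2, hc1, hc2, rfl⟩ :=
          exists_add_of_le_of_lt (L := 4 * P) (x := B) (by omega) (by omega)
        exact Or.inr (Or.inr (Or.inl ⟨_, hx A (by omega) (by omega), _, hy b hb1 hb2,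
          _, hy c hc1 hc2, by rw [hN]; ring⟩))
      · obtain ⟨a, a', ha1, ha2, ha3, ha4, rfl⟩ :=
          exists_add_of_le_of_lt (L := 2 * (4 * P)) (x := A) (by omega) (by omega)
        exact Or.inr (Or.inl ⟨_, hx a ha1 ha2, _, hx a' ha3 ha4,
          _, hy B (by omega) (by omega), by rw [hN]; ring⟩)
      · obtain ⟨a, a', ha1, ha2, ha3, ha4, rfl⟩ :=
          exists_add_of_le_of_lt (L := 2 * (4 * P)) (x := A) (by omega) (by omega)
        obtain ⟨b, c, hb1, hb2, hc1, hc2, rfl⟩ :=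
          exists_add_of_le_of_lt (L := 4 * P) (x := B) (by omega) (by omega)
        exact Or.inr (Or.inr (Or.inr (Or.inr (Or.inl ⟨_, hx a ha1 ha2, _, hx a' ha3 ha4,
          _, hy b hb1 hb2, _, hy c hc1 hc2, by rw [hN]; ring⟩))))
    · lift A to ℕ using by omega
      lift B to ℕ using by omega
      lift C to ℕ using by omega
      have hN : N = A * (16 * P + 1) + B * (8 * P + 1) + C * (4 * P + 1) := by exact_mod_cast hN
      by_cases hA : A < 4 * (4 * P)
      · exact Or.inr (Or.inr (Or.inr (Or.inl ⟨_, hx A (by omega) (by omega),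
          _, hy B (by omega) (by omega), _, hz C (by omega) (by omega), hN⟩)))
      · obtain ⟨a, a', ha1, ha2, ha3, ha4, rfl⟩ :=
          exists_add_of_le_of_lt (L := 2 * (4 * P)) (x := A) (by omega) (by omega)
        exact Or.inr (Or.inr (Or.inr (Or.inr (Or.inr ⟨_, hx a ha1 ha2, _, hx a' ha3 ha4,
          _, hy B (by omega) (by omega), _, hz C (by omega) (by omega), by rw [hN]; ring⟩))))
  · rintro n ⟨k, rfl⟩ hn N ⟨-, hN1, hN2⟩
    obtain ⟨k, rfl⟩ : ∃ l, k = l + 6 := ⟨k - 6, by omega⟩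
    have hR : 8 ≤ 2 ^ k := (by norm_num : 8 = 2 ^ 3) ▸ Nat.pow_le_pow_right (by norm_num) (by omega)
    have hw : ∀ a, 32 * 2 ^ k ≤ a → a < 64 * 2 ^ k →
        a * (64 * 2 ^ k + 1) ∈ binSquares (k + 6 + (k + 6)) := fun a h1 h2 ↦ by
      have := mul_mem_binSquares (m := k + 6) (n := k + 6 + (k + 6)) (a := a) (by omega)
        (by omega) (by rw [show k + 6 - 1 = k + 5 by omega, pow_add]; omega)
        (by rw [pow_add]; omega)
      rwa [pow_add, mul_comm (2 ^ k)] at this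
    have hx : ∀ a, 16 * 2 ^ k ≤ a → a < 2 * (16 * 2 ^ k) →
        a * (32 * 2 ^ k + 1) ∈ binSquares (k + 6 + (k + 6) - 2) := fun a h1 h2 ↦ by
      have := mul_mem_binSquares (m := k + 5) (n := k + 6 + (k + 6) - 2) (a := a) (by omega)
        (by omega) (by rw [show k + 5 - 1 = k + 4 by omega, pow_add]; omega)
        (by rw [pow_add]; omega)
      rwa [pow_add, mul_comm (2 ^ k)] at this
    have hy : ∀ a, 8 * 2 ^ k ≤ a → a < 2 * (8 * 2 ^ k) →
        a * (16 * 2 ^ k + 1) ∈ binSquares (k + 6 + (k + 6) - 4) := fun a h1 h2 ↦ by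
      have := mul_mem_binSquares (m := k + 4) (n := k + 6 + (k + 6) - 4) (a := a) (by omega)
        (by omega) (by rw [show k + 4 - 1 = k + 3 by omega, pow_add]; omega)
        (by rw [pow_add]; omega)
      rwa [pow_add, mul_comm (2 ^ k)] at this
    have hz : ∀ a, 4 * 2 ^ k ≤ a → a < 8 * 2 ^ k →
        a * (8 * 2 ^ k + 1) ∈ binSquares (k + 6 + (k + 6) - 6) := fun a h1 h2 ↦ by
      have := mul_mem_binSquares (m := k + 3) (n := k + 6 + (k + 6) - 6) (a := a) (by omega)
        (by omega) (by rw [show k + 3 - 1 = k + 2 by omega, pow_add]; omega)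
        (by rw [pow_add]; omega)
      rwa [pow_add, mul_comm (2 ^ k)] at this
    have hN1' : 32 * (8 * 2 ^ k) ^ 2 ≤ N := by
      rw [show k + 6 + (k + 6) - 1 = k + k + 11 by omega, pow_add, pow_add] at hN1
      linarith
    have hN2' : N < 64 * (8 * 2 ^ k) ^ 2 := by
      rw [show k + 6 + (k + 6) = k + k + 12 by omega, pow_add, pow_add] at hN2
      linarith
    clear hN1 hN2
    generalize 2 ^ k = R at *
    rcases even_representation (R := R) (N := N) (by exact_mod_cast hR) (by exact_mod_cast hN1')
      (by exact_mod_cast hN2') with ⟨A, B, hN, hA1, hA2, hB1, hB2⟩ |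
        ⟨A, B, hN, hA1, hA2, hB1, hB2⟩ | ⟨A, B, C, hN, hA1, hA2, hB1, hB2, hC1, hC2⟩ |
        ⟨A, B, C, hN, hA1, hA2, hB1, hB2, hC1, hC2⟩ <;>
      lift A to ℕ using (by omega) <;> lift B to ℕ using (by omega)
    · have hN : N = A * (32 * R + 1) + B * (16 * R + 1) := by exact_mod_cast hN
      obtain ⟨a, a', ha1, ha2, ha3, ha4, rfl⟩ :=
        exists_add_of_le_of_lt (L := 16 * R) (x := A) (by omega) (by omega)
      obtain ⟨b, c, hb1, hb2, hc1, hc2, rfl⟩ :=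
        exists_add_of_le_of_lt (L := 8 * R) (x := B) (by omega) (by omega)
      exact Or.inl ⟨_, hx a ha1 ha2, _, hx a' ha3 ha4, _, hy b hb1 hb2, _, hy c hc1 hc2,
        by rw [hN]; ring⟩
    · have hN : N = A * (32 * R + 1) + B * (16 * R + 1) := by exact_mod_cast hN
      obtain ⟨a, b, c, ha1, ha2, hb1, hb2, hc1, hc2, rfl⟩ :=
        exists_add_add_of_le_of_lt (L := 16 * R) (x := A) (by omega) (by omega)
      exact Or.inr (Or.inl ⟨_, hx a ha1 ha2, _, hx b hb1 hb2, _, hx c hc1 hc2,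
        _, hy B (by omega) (by omega), by rw [hN]; ring⟩)
    · lift C to ℕ using by omega
      exact Or.inr (Or.inr (Or.inl ⟨_, hw A (by omega) (by omega), _, hy B (by omega) (by omega),
        _, hz C (by omega) (by omega), by exact_mod_cast hN⟩))
    · lift C to ℕ using by omega
      have hN : N = A * (32 * R + 1) + B * (16 * R + 1) + C * (8 * R + 1) := by exact_mod_cast hN
      obtain ⟨a, a', ha1, ha2, ha3, ha4, rfl⟩ :=
        exists_add_of_le_of_lt (L := 16 * R) (x := A) (by omega) (by omega)
      exact Or.inr (Or.inr (Or.inr ⟨_, hx a ha1 ha2, _, hx a' ha3 ha4,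
        _, hy B (by omega) (by omega), _, hz C (by omega) (by omega), by rw [hN]; ring⟩))
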